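/- Let $\mathbb{K}$ be a local field of characteristic zero (a non-discrete locally compact field of characteristic zero), let $V$ be a finite-dimensional vector space over $\mathbb{K}$, and let $P(V)$ be its projective space with the quotient topology from $V\setminus\{0\}$. Let $PGL(V)$ be the group of all transformations of $P(V)$ induced by elements of $GL(V)$, with the quotient topology from $GL(V)$. Let $G$ be an algebraic subgroup of $PGL(V)$, that is, the group of $\mathbb{K}$-points of an algebraic subgroup defined over $\mathbb{K}$ (equivalently, a subgroup whose preimage in $GL(V)$ is the set of common zeros in $GL(V)$ of a family of polynomials over $\mathbb{K}$ in the matrix entries), and let $\mu$ be a Borel probability measure on $P(V)$. Put $$\mathcal{I}_G(\mu)=\{g\in G \mid g\mu=\mu\},\qquad I_G(\mu)=\{g\in G \mid gx=x \text{ for all } x\in S(\mu)\},$$ where $g\mu$ is the image of $\mu$ under $g$ and $S(\mu)$ is the support of $\mu$. Then $I_G(\mu)$ is a normal subgroup of $\mathcal{I}_G(\mu)$, and $\mathcal{I}_G(\mu)/I_G(\mu)$, with the quotient topology, is a compact (Hausdorff) topological group. -/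

import Mathlib

open MeasureTheory Topology
open scoped LinearAlgebra.Projectivization

namespace ProjStab

section Space

variable (K V : Type*) [NontriviallyNormedField K] [NormedAddCommGroup V] [NormedSpace K V]

/-- The projective space `P(V)` carries the quotient topology of `V ∖ {0}`. -/
instance instTopologicalSpaceProj : TopologicalSpace (ℙ K V) :=
  TopologicalSpace.coinduced (fun v : {v : V // v ≠ 0} => Projectivization.mk K v.1 v.2)
    inferInstance

/-- The projective space `P(V)` carries its Borel σ-algebra. -/
instance instMeasurableSpaceProj : MeasurableSpace (ℙ K V) := borel (ℙ K V)

instance instBorelSpaceProj : BorelSpace (ℙ K V) := ⟨rfl⟩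

/-- The topological group `GL(V)` (all linear maps are continuous when `K` is complete and `V` is
finite-dimensional). -/
abbrev GLV : Type _ := (V →L[K] V)ˣ

/-- The homomorphism `Π` that sends `g ∈ GL(V)` to the transformation of `P(V)` it induces. -/
abbrev projHom : GLV K V →* Equiv.Perm (ℙ K V) := MulAction.toPermHom (GLV K V) (ℙ K V)

/-- `PGL(V)`, the group of all `Π(g)` with `g ∈ GL(V)`, realized as `GL(V) / ker Π` with the
quotient topology. -/
abbrev PGLV : Type _ := GLV K V ⧸ (projHom K V).ker

/-- The (faithful) action of `PGL(V)` on `P(V)`. -/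
instance instMulActionPGLV : MulAction (PGLV K V) (ℙ K V) :=
  MulAction.compHom (ℙ K V) (QuotientGroup.kerLift (projHom K V))

end Space

section Action

variable {K V : Type*} [NontriviallyNormedField K] [NormedAddCommGroup V] [NormedSpace K V]

theorem mk_smul_proj (g : GLV K V) (x : ℙ K V) :
    (QuotientGroup.mk g : PGLV K V) • x = g • x := rfl

theorem continuous_smul_proj (g : PGLV K V) : Continuous (fun x : ℙ K V => g • x) := by
  induction g using QuotientGroup.induction_on with
  | H g =>
    refine continuous_coinduced_dom.2 ?_
    have h : Continuous (fun v : {v : V // v ≠ 0} =>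
        (⟨(g : V →L[K] V) v.1, (smul_ne_zero_iff_ne g).2 v.2⟩ : {v : V // v ≠ 0})) :=
      ((g : V →L[K] V).continuous.comp continuous_subtype_val).subtype_mk _
    exact continuous_coinduced_rng.comp h

theorem measurable_smul_proj (g : PGLV K V) : Measurable (fun x : ℙ K V => g • x) :=
  (continuous_smul_proj g).measurable

/-- `G ≤ PGL(V)` is an algebraic subgroup (the group of `K`-points of an algebraic subgroup
defined over `K`): its preimage in `GL(V)` is the set of common zeros in `GL(V)` of a set of
polynomials over `K` in the matrix entries. -/
def IsAlgebraicSubgroup [FiniteDimensional K V] (G : Subgroup (PGLV K V)) : Prop :=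
  ∃ S : Set (MvPolynomial (Fin (Module.finrank K V) × Fin (Module.finrank K V)) K),
    ∀ g : GLV K V, (QuotientGroup.mk g : PGLV K V) ∈ G ↔
      ∀ p ∈ S, MvPolynomial.eval
        (fun ij => LinearMap.toMatrix (Module.finBasis K V) (Module.finBasis K V)
          ((g : V →L[K] V) : V →ₗ[K] V) ij.1 ij.2) p = 0

/-- `𝓘_G(μ)`: the elements `g` of `G` with `g μ = μ`. -/
def measureStabilizer (G : Subgroup (PGLV K V)) (μ : Measure (ℙ K V)) : Subgroup G where
  carrier := {g | μ.map (fun x => (g : PGLV K V) • x) = μ}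
  one_mem' := by simp
  mul_mem' := by
    intro a b ha hb
    have ha' : μ.map (fun x => (a : PGLV K V) • x) = μ := ha
    have hb' : μ.map (fun x => (b : PGLV K V) • x) = μ := hb
    change μ.map (fun x => ((a * b : G) : PGLV K V) • x) = μ
    have h : (fun x : ℙ K V => ((a * b : G) : PGLV K V) • x) =
        (fun x => (a : PGLV K V) • x) ∘ (fun x => (b : PGLV K V) • x) := by
      funext x
      exact mul_smul (a : PGLV K V) (b : PGLV K V) x
    rw [h, ← Measure.map_map (measurable_smul_proj _) (measurable_smul_proj _), hb', ha']
  inv_mem' := by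
    intro a ha
    have ha' : μ.map (fun x => (a : PGLV K V) • x) = μ := ha
    change μ.map (fun x => ((a⁻¹ : G) : PGLV K V) • x) = μ
    conv_lhs => rw [← ha']
    rw [Measure.map_map (measurable_smul_proj _) (measurable_smul_proj _)]
    have h : (fun x : ℙ K V => ((a⁻¹ : G) : PGLV K V) • x) ∘
        (fun x => (a : PGLV K V) • x) = id := by
      funext x
      exact inv_smul_smul (a : PGLV K V) x
    rw [h, Measure.map_id]

/-- `I_G(μ)`: the elements of `G` that fix every point of the support of `μ`. -/
def supportFixator (G : Subgroup (PGLV K V)) (μ : Measure (ℙ K V)) : Subgroup G where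
  carrier := {g | ∀ x ∈ μ.support, (g : PGLV K V) • x = x}
  one_mem' := fun x _ => one_smul (PGLV K V) x
  mul_mem' := by
    intro a b ha hb x hx
    have h : ((a * b : G) : PGLV K V) • x = (a : PGLV K V) • (b : PGLV K V) • x :=
      mul_smul (a : PGLV K V) (b : PGLV K V) x
    rw [h, hb x hx, ha x hx]
  inv_mem' := by
    intro a ha x hx
    exact inv_smul_eq_iff.2 (ha x hx).symm

end Action

end ProjStab

/-! Fixing the support pointwise amounts to fixing one suitable finite tuple of its points, or any
tuple of support points close to it (`exists_isOpen_fixator`). The stabilizer of μ preserves the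
product measure ν on tuples. Suppose a set C of such tuples, with ν C > 0, has the following
property: whenever an element k of G carries some x ∈ C into C, some k' in G from a fixed compact
neighbourhood of 1 satisfies k' x = k x. As ν is finite, packing
(`exists_finset_forall_exists_smul_mem`) gives finitely many t such that every g in the stabilizer
has t⁻¹ g x ∈ C for some t and some x ∈ C. Then t⁻¹ g x = k' x, so k'⁻¹ t⁻¹ g fixes x and hence the
whole support. Thus finitely many translates of a compact set cover the quotient. It is Hausdorff
because the fixator is closed.

The set C comes from `exists_local_transporter`, where algebraicity enters. Over a complete field of
characteristic zero, a polynomial map on K-points is open, relative to its image, off a proper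
Zariski closed set (`exists_generic_openness`). Adjoining one generator at a time reduces this to
the continuity of simple roots. It is applied to the graph map (g, x) ↦ (x, g x), with x in a
Zariski closed set minimal among those of positive measure, so that for a suitable g₀ the
exceptional x form a null set. -/

namespace ProjStab


/-! ### Generic openness on K-points of finitely generated domains. -/

section GenericOpenness

open Polynomial Filter

/-- A simple root of a polynomial of bounded degree moves continuously with the coefficients. -/
theorem eventually_exists_root_mem {K : Type*} [NontriviallyNormedField K] [CompleteSpace K]
    {n : ℕ} {a : Fin n → K} {y : K} (h₀ : ∑ i, a i * y ^ (i : ℕ) = 0)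
    (h₁ : ∑ i, a i * ((i : ℕ) * y ^ ((i : ℕ) - 1)) ≠ 0) {U : Set K} (hU : U ∈ 𝓝 y) :
    ∀ᶠ c : Fin n → K in 𝓝 a, ∃ z ∈ U, ∑ i, c i * z ^ (i : ℕ) = 0 := by
  let G : (Fin n → K) × K → K := fun p => ∑ i, p.1 i * p.2 ^ (i : ℕ)
  let G' : (Fin n → K) × K →L[K] K :=
    ∑ i : Fin n, (a i • (((i : ℕ) * y ^ ((i : ℕ) - 1)) • ContinuousLinearMap.snd K (Fin n → K) K)
      + y ^ (i : ℕ) • ((ContinuousLinearMap.proj i).comp (ContinuousLinearMap.fst K (Fin n → K) K)))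
  have hG : HasStrictFDerivAt G G' (a, y) := by
    refine HasStrictFDerivAt.fun_sum fun i _ => ?_
    have h1 : HasStrictFDerivAt (fun p : (Fin n → K) × K => p.1 i)
        ((ContinuousLinearMap.proj i).comp (ContinuousLinearMap.fst K (Fin n → K) K)) (a, y) :=
      ((ContinuousLinearMap.proj (R := K) (φ := fun _ : Fin n => K) i).comp
        (ContinuousLinearMap.fst K (Fin n → K) K)).hasStrictFDerivAt
    have h2 : HasStrictFDerivAt (fun p : (Fin n → K) × K => p.2 ^ (i : ℕ))
        (((i : ℕ) * y ^ ((i : ℕ) - 1)) • ContinuousLinearMap.snd K (Fin n → K) K) (a, y) :=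
      (hasStrictDerivAt_pow (i : ℕ) y).comp_hasStrictFDerivAt (a, y) hasStrictFDerivAt_snd
    exact h1.mul h2
  -- The map (c, z) ↦ (c, ∑ cᵢ zⁱ) has surjective strict derivative at (a, y), so it sends
  -- neighbourhoods of (a, y) onto neighbourhoods of (a, 0).
  have hF := (hasStrictFDerivAt_fst (𝕜 := K) (p := (a, y))).prodMk hG
  have hG1 : ∀ t, G' (0, t) = (∑ i, a i * ((i : ℕ) * y ^ ((i : ℕ) - 1))) * t := by
    intro t
    simp [G', Finset.sum_mul, mul_assoc]
  have hsurj : ((ContinuousLinearMap.fst K (Fin n → K) K).prod G').range = ⊤ := by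
    refine LinearMap.range_eq_top.2 fun q => ?_
    refine ⟨(q.1, (q.2 - G' (q.1, 0)) / ∑ i, a i * ((i : ℕ) * y ^ ((i : ℕ) - 1))), ?_⟩
    refine Prod.ext rfl ?_
    change G' _ = _
    rw [show ∀ s : K, ((q.1, s) : (Fin n → K) × K) = (q.1, 0) + (0, s) from fun s => by simp,
      map_add, hG1, mul_div_cancel₀ _ h₁]
    ring
  have hmap := hF.map_nhds_eq_of_surj hsurj
  have hy : Set.univ ×ˢ U ∈ 𝓝 (a, y) := prod_mem_nhds univ_mem hU
  have himg := image_mem_map (m := fun p : (Fin n → K) × K => (p.1, G p)) hy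
  rw [hmap, show G (a, y) = 0 from h₀] at himg
  have hc : Tendsto (fun c : Fin n → K => (c, (0 : K))) (𝓝 a) (𝓝 (a, 0)) :=
    (continuous_id.prodMk continuous_const).tendsto a
  filter_upwards [hc himg] with c hcm
  obtain ⟨⟨c', z⟩, ⟨-, hz⟩, he⟩ := hcm
  simp only [Prod.mk.injEq] at he
  obtain ⟨rfl, he⟩ := he
  exact ⟨z, hz, he⟩

section Points

variable {K : Type*} [NontriviallyNormedField K]
variable {R B : Type*} [CommRing R] [Algebra K R] [CommRing B] [Algebra K B]

/-- The neighbourhoods of a `K`-point `χ` of `R` in the topology of pointwise convergence. -/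
def pointNhds (χ : R →ₐ[K] K) : Filter (R →ₐ[K] K) :=
  comap (fun ψ r => ψ r) (𝓝 (fun r => χ r))

theorem tendsto_pointNhds {α : Type*} {l : Filter α} {u : α → R →ₐ[K] K} {χ : R →ₐ[K] K} :
    Tendsto u l (pointNhds χ) ↔ ∀ r, Tendsto (fun a => u a r) l (𝓝 (χ r)) := by
  rw [pointNhds, tendsto_comap_iff, tendsto_pi_nhds]
  rfl

theorem tendsto_apply_pointNhds (χ : R →ₐ[K] K) (r : R) :
    Tendsto (fun ψ : R →ₐ[K] K => ψ r) (pointNhds χ) (𝓝 (χ r)) :=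
  tendsto_pointNhds.1 tendsto_id r

/-- The map of `K`-points induced by `f` is open at `χ`. -/
def OpenAtPoint (f : R →ₐ[K] B) (χ : B →ₐ[K] K) : Prop :=
  pointNhds (χ.comp f) ≤ map (fun ψ => ψ.comp f) (pointNhds χ)

theorem OpenAtPoint.comp {A : Type*} [CommRing A] [Algebra K A] {g : A →ₐ[K] R} {f : R →ₐ[K] B}
    {χ : B →ₐ[K] K} (hf : OpenAtPoint f χ) (hg : OpenAtPoint g (χ.comp f)) :
    OpenAtPoint (f.comp g) χ := by
  have h := hg.trans (map_mono hf)
  rwa [map_map] at h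

theorem eventually_exists_root_pointNhds [CompleteSpace K] (P : R[X]) {χ : R →ₐ[K] K} {y : K}
    (h₀ : P.eval₂ (χ : R →+* K) y = 0) (h₁ : P.derivative.eval₂ (χ : R →+* K) y ≠ 0)
    {U : Set K} (hU : U ∈ 𝓝 y) :
    ∀ᶠ ψ : R →ₐ[K] K in pointNhds χ, ∃ z ∈ U, P.eval₂ (ψ : R →+* K) z = 0 := by
  have hsum : ∀ (ψ : R →ₐ[K] K) (z : K), P.eval₂ (ψ : R →+* K) z =
      ∑ i : Fin (P.natDegree + 1), ψ (P.coeff i) * z ^ (i : ℕ) := by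
    intro ψ z
    rw [eval₂_eq_sum_range, Finset.sum_range]
    rfl
  have hder : P.derivative.eval₂ (χ : R →+* K) y =
      ∑ i : Fin (P.natDegree + 1), χ (P.coeff i) * ((i : ℕ) * y ^ ((i : ℕ) - 1)) := by
    rw [derivative_apply, sum_over_range _ (by simp), eval₂_finsetSum, Finset.sum_range]
    refine Finset.sum_congr rfl fun i _ => ?_
    simp [mul_assoc]
  rw [hsum] at h₀
  rw [hder] at h₁
  have ht : Tendsto (fun (ψ : R →ₐ[K] K) (i : Fin (P.natDegree + 1)) => ψ (P.coeff i))
      (pointNhds χ) (𝓝 fun i : Fin (P.natDegree + 1) => χ (P.coeff i)) :=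
    tendsto_pi_nhds.2 fun i => tendsto_apply_pointNhds χ _
  filter_upwards [ht (eventually_exists_root_mem h₀ h₁ hU)] with ψ hψ
  obtain ⟨z, hz, h⟩ := hψ
  exact ⟨z, hz, (hsum ψ z).trans h⟩

/-- B is the quotient of R[X] by the relations of y, so the point (ψ, z) of R[X] descends to B once
it kills them. -/
theorem exists_comp_eq_of_eval₂ (f : R →ₐ[K] B) {y : B}
    (hy : ∀ b, ∃ Q : R[X], Q.eval₂ (f : R →+* B) y = b) (ψ : R →ₐ[K] K) (z : K)
    (h : ∀ Q : R[X], Q.eval₂ (f : R →+* B) y = 0 → Q.eval₂ (ψ : R →+* K) z = 0) :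
    ∃ χ : B →ₐ[K] K, χ.comp f = ψ ∧ χ y = z := by
  let F : R[X] →ₐ[K] B := eval₂AlgHom f y fun _ => Commute.all _ _
  let g : R[X] →ₐ[K] K := eval₂AlgHom ψ z fun _ => Commute.all _ _
  have hF : Function.Surjective F := hy
  have hlift := AlgHom.liftOfSurjective_apply F hF g (fun Q hQ => h Q hQ)
  refine ⟨AlgHom.liftOfSurjective F hF g (fun Q hQ => h Q hQ), ?_, ?_⟩
  · ext r
    have := hlift (C r)
    simpa [F, g] using this
  · have := hlift X
    simpa [F, g] using this

/-- Each value χ' b is a fixed polynomial expression in χ' y with coefficients from χ' ∘ f, hence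
depends continuously on these data. -/
theorem eventually_mem_of_pointNhds (f : R →ₐ[K] B) {y : B}
    (hy : ∀ b, ∃ Q : R[X], Q.eval₂ (f : R →+* B) y = b) {χ : B →ₐ[K] K} {s : Set (B →ₐ[K] K)}
    (hs : s ∈ pointNhds χ) :
    ∀ᶠ p : (R →ₐ[K] K) × K in pointNhds (χ.comp f) ×ˢ 𝓝 (χ y),
      ∀ χ' : B →ₐ[K] K, χ'.comp f = p.1 → χ' y = p.2 → χ' ∈ s := by
  choose Q hQ using hy
  have key : ∀ (χ' : B →ₐ[K] K) b,
      (Q b).eval₂ ((χ'.comp f : R →ₐ[K] K) : R →+* K) (χ' y) = χ' b := by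
    intro χ' b
    conv_rhs => rw [← hQ b]
    exact ((Q b).hom_eval₂ (f : R →+* B) (χ' : B →+* K) y).symm
  obtain ⟨T, hT, hTs⟩ := mem_comap.1 hs
  have ht : Tendsto (fun (p : (R →ₐ[K] K) × K) (b : B) => (Q b).eval₂ (p.1 : R →+* K) p.2)
      (pointNhds (χ.comp f) ×ˢ 𝓝 (χ y)) (𝓝 fun b => χ b) := by
    refine tendsto_pi_nhds.2 fun b => ?_
    rw [← key χ b]
    simp only [eval₂_eq_sum_range]
    refine tendsto_finsetSum _ fun i _ => Tendsto.mul ?_ (Tendsto.pow tendsto_snd _)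
    exact (tendsto_apply_pointNhds (χ.comp f) _).comp tendsto_fst
  filter_upwards [ht hT] with p hp χ' h1 h2
  refine hTs ?_
  have : (fun b => χ' b) = fun b => (Q b).eval₂ (p.1 : R →+* K) p.2 := by
    funext b
    rw [← key χ' b, h1, h2]
  change (fun b => χ' b) ∈ T
  rw [this]
  exact hp

theorem openAtPoint_of_eventually (f : R →ₐ[K] B) {y : B}
    (hy : ∀ b, ∃ Q : R[X], Q.eval₂ (f : R →+* B) y = b) {χ : B →ₐ[K] K}
    (h : ∀ U ∈ 𝓝 (χ y), ∀ᶠ ψ : R →ₐ[K] K in pointNhds (χ.comp f), ∃ z ∈ U,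
      ∀ Q : R[X], Q.eval₂ (f : R →+* B) y = 0 → Q.eval₂ (ψ : R →+* K) z = 0) :
    OpenAtPoint f χ := by
  refine le_map fun s hs => ?_
  obtain ⟨pa, ha, pb, hb, hab⟩ := eventually_prod_iff.1 (eventually_mem_of_pointNhds f hy hs)
  filter_upwards [ha, h _ hb] with ψ hψ ⟨z, hz, hq⟩
  obtain ⟨χ', h1, h2⟩ := exists_comp_eq_of_eval₂ f hy ψ z hq
  exact ⟨χ', hab hψ hz χ' h1 h2, h1⟩

/-- If y is transcendental over R, the map is a projection along a line and is open everywhere. If y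
is algebraic with relation P of least degree, points lift by following the root y of P; this works
where the leading coefficient of P and P'(y) do not vanish. -/
theorem exists_ne_zero_openAtPoint_of_eval₂ [CompleteSpace K] [CharZero K] [IsDomain R]
    [IsDomain B] (f : R →ₐ[K] B) (hf : Function.Injective f) {y : B}
    (hy : ∀ b, ∃ Q : R[X], Q.eval₂ (f : R →+* B) y = b) :
    ∃ D : B, D ≠ 0 ∧ ∀ χ : B →ₐ[K] K, χ D ≠ 0 → OpenAtPoint f χ := by
  by_cases htr : ∀ Q : R[X], Q.eval₂ (f : R →+* B) y = 0 → Q = 0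
  · refine ⟨1, one_ne_zero, fun χ _ => openAtPoint_of_eventually f hy fun U hU => ?_⟩
    refine Eventually.of_forall fun ψ => ⟨χ y, mem_of_mem_nhds hU, fun Q hQ => ?_⟩
    simp [htr Q hQ]
  push Not at htr
  obtain ⟨P, ⟨hP0, hPne⟩, hmin⟩ : ∃ P : R[X], (P.eval₂ (f : R →+* B) y = 0 ∧ P ≠ 0) ∧
      ∀ Q : R[X], Q.eval₂ (f : R →+* B) y = 0 → Q.natDegree < P.natDegree → Q = 0 := by
    let s : Set R[X] := {P | P.eval₂ (f : R →+* B) y = 0 ∧ P ≠ 0}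
    have hs : s.Nonempty := htr
    refine ⟨Function.argminOn natDegree s hs, Function.argminOn_mem natDegree s hs, ?_⟩
    intro Q hQ hlt
    by_contra hne
    exact Function.not_lt_argminOn natDegree s (a := Q) ⟨hQ, hne⟩ hlt
  have hf' : Function.Injective (f : R →+* B) := hf
  have hdeg : 0 < P.natDegree := by
    by_contra h0
    obtain ⟨c, rfl⟩ := natDegree_eq_zero.1 (Nat.eq_zero_of_not_pos h0)
    rw [eval₂_C] at hP0
    exact hPne (by rw [(map_eq_zero_iff _ hf').1 hP0, C_0])
  have hR : CharZero R := charZero_of_injective_algebraMap (algebraMap K R).injective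
  -- In characteristic zero P' is nonzero of smaller degree, so minimality of P forbids P'(y) = 0.
  have hder : P.derivative.eval₂ (f : R →+* B) y ≠ 0 := by
    intro h0
    have := hmin _ h0 (natDegree_derivative_lt hdeg.ne')
    exact hdeg.ne' (derivative_eq_zero.1 this)
  refine ⟨f P.leadingCoeff * P.derivative.eval₂ (f : R →+* B) y,
    mul_ne_zero ((map_ne_zero_iff _ hf).2 (leadingCoeff_ne_zero.2 hPne)) hder, ?_⟩
  intro χ hχ
  rw [map_mul, mul_ne_zero_iff] at hχ
  refine openAtPoint_of_eventually f hy fun U hU => ?_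
  have ev : ∀ Q : R[X], χ (Q.eval₂ (f : R →+* B) y) =
      Q.eval₂ ((χ.comp f : R →ₐ[K] K) : R →+* K) (χ y) := fun Q =>
    Q.hom_eval₂ (f : R →+* B) (χ : B →+* K) y
  have hroot := eventually_exists_root_pointNhds P (χ := χ.comp f) (y := χ y)
    (by rw [← ev, hP0, map_zero]) (by rw [← ev]; exact hχ.2) hU
  have hlc : ∀ᶠ ψ in pointNhds (χ.comp f), ψ P.leadingCoeff ≠ 0 :=
    (tendsto_apply_pointNhds (χ.comp f) _).eventually_ne hχ.1
  filter_upwards [hroot, hlc] with ψ ⟨z, hz, hPz⟩ hc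
  refine ⟨z, hz, ?_⟩
  -- Pseudo-division by P: `cancelLeads` is lc(P) Q minus a multiple of P (the truncated exponent on
  -- Q is 0), has smaller degree, and is again a relation. Since ψ(lc P) ≠ 0, a root of P under ψ is
  -- a root of every relation.
  have claim : ∀ (n : ℕ) (Q : R[X]), Q.natDegree < n → Q.eval₂ (f : R →+* B) y = 0 →
      Q.eval₂ (ψ : R →+* K) z = 0 := by
    intro n
    induction n with
    | zero => intro Q h; omega
    | succ n ih =>
      intro Q hn hQ
      by_cases hlt : Q.natDegree < P.natDegree
      · simp [hmin Q hQ hlt]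
      have hle : P.natDegree ≤ Q.natDegree := not_lt.1 hlt
      have hlt' := natDegree_cancelLeads_lt_of_natDegree_le_natDegree hle (hdeg.trans_le hle)
      have hz' := ih (P.cancelLeads Q) (by omega)
        (by simp [cancelLeads, eval₂_mul, hQ, hP0])
      rw [cancelLeads, tsub_eq_zero_iff_le.2 hle, pow_zero, mul_one, eval₂_sub, eval₂_mul,
        eval₂_mul, hPz, mul_zero, sub_zero, eval₂_C] at hz'
      exact (mul_eq_zero.1 hz').resolve_left hc
  exact fun Q hQ => claim _ Q (Nat.lt_succ_self _) hQ

theorem exists_ne_zero_openAtPoint_val [CompleteSpace K] [CharZero K] [IsDomain B]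
    (s : Finset B) (R : Subalgebra K B) (hR : R ⊔ Algebra.adjoin K (s : Set B) = ⊤) :
    ∃ D : B, D ≠ 0 ∧ ∀ χ : B →ₐ[K] K, χ D ≠ 0 → OpenAtPoint R.val χ := by
  classical
  induction s using Finset.induction_on generalizing R with
  | empty =>
    simp only [Finset.coe_empty, Algebra.adjoin_empty, sup_bot_eq] at hR
    subst hR
    -- Here R is all of B, so constant polynomials suffice and the value of `y` is immaterial.
    refine exists_ne_zero_openAtPoint_of_eval₂ _ Subtype.val_injective (y := 0)
      fun b => ⟨C ⟨b, trivial⟩, by simp⟩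
  | insert y s _ ih =>
    have hle : R ≤ R ⊔ Algebra.adjoin K {y} := le_sup_left
    obtain ⟨D, hD0, hD⟩ := ih (R ⊔ Algebra.adjoin K {y}) (by
      rw [sup_assoc, ← Algebra.adjoin_union, Set.singleton_union, ← Finset.coe_insert, hR])
    have hyR : y ∈ R ⊔ Algebra.adjoin K {y} :=
      (le_sup_right : _ ≤ R ⊔ Algebra.adjoin K {y}) (Algebra.subset_adjoin rfl)
    let F : R[X] →ₐ[K] B := eval₂AlgHom R.val y fun _ => Commute.all _ _
    have hF : R ⊔ Algebra.adjoin K {y} ≤ F.range := by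
      refine sup_le (fun r hr => ⟨C ⟨r, hr⟩, by simp [F]⟩) (Algebra.adjoin_le ?_)
      rintro _ rfl
      exact ⟨X, by simp [F]⟩
    obtain ⟨D', hD'0, hD'⟩ := exists_ne_zero_openAtPoint_of_eval₂ (Subalgebra.inclusion hle)
      (Subalgebra.inclusion_injective hle) (y := ⟨y, hyR⟩) (by
        rintro ⟨b, hb⟩
        obtain ⟨Q, hQ⟩ := hF hb
        refine ⟨Q, Subtype.ext ?_⟩
        have h := Q.hom_eval₂ (Subalgebra.inclusion hle : R →+* ↥(R ⊔ Algebra.adjoin K {y}))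
          ((R ⊔ Algebra.adjoin K {y}).val : ↥(R ⊔ Algebra.adjoin K {y}) →+* B) ⟨y, hyR⟩
        exact h.trans hQ)
    refine ⟨D * D', mul_ne_zero hD0 fun h => hD'0 (Subtype.ext h), fun χ hχ => ?_⟩
    rw [map_mul, mul_ne_zero_iff] at hχ
    have hcomp : (R ⊔ Algebra.adjoin K {y}).val.comp (Subalgebra.inclusion hle) = R.val :=
      AlgHom.ext fun _ => rfl
    rw [← hcomp]
    exact (hD χ hχ.1).comp (hD' (χ.comp (R ⊔ Algebra.adjoin K {y}).val) hχ.2)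

end Points

end GenericOpenness


/-! ### Generic openness for polynomial maps on arbitrary sets of K-points. -/

section ZariskiOpenness

open MvPolynomial Filter

/-- Take h in all the other minimal primes but not in p; then h a lies in every minimal prime of I,
and these intersect in I. Geometrically, where h ≠ 0 only the component of p is present. -/
theorem exists_notMem_mul_mem_of_mem_minimalPrimes {A : Type*} [CommRing A] [IsNoetherianRing A]
    {I p : Ideal A} (hI : I.IsRadical) (hp : p ∈ I.minimalPrimes) :
    ∃ h, h ∉ p ∧ ∀ a ∈ p, h * a ∈ I := by
  classical
  have hfin := I.finite_minimalPrimes_of_isNoetherianRing A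
  have hpp : p.IsPrime := hp.1.1
  have hnot : ¬ ((hfin.toFinset.erase p).inf id ≤ p) := by
    rw [hpp.inf_le']
    rintro ⟨q, hq, hqp⟩
    rw [Finset.mem_erase, Set.Finite.mem_toFinset] at hq
    exact hq.1 (le_antisymm hqp (hp.2 hq.2.1 hqp))
  obtain ⟨h, hh, hhp⟩ := SetLike.not_le_iff_exists.1 hnot
  refine ⟨h, hhp, fun a ha => ?_⟩
  rw [← hI.radical, ← I.sInf_minimalPrimes, Submodule.mem_sInf]
  intro q hq
  by_cases hqp : q = p
  · exact hqp ▸ p.mul_mem_left h ha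
  · have hle : (hfin.toFinset.erase p).inf id ≤ q :=
      Finset.inf_le (f := id) (Finset.mem_erase.2 ⟨hqp, hfin.mem_toFinset.2 hq⟩)
    exact Ideal.mul_mem_right a q (hle hh)

/-- A polynomial map `F` from a set `Z` of `K`-points to affine space is open, as a map from the
Zariski closure of `Z`, at the points of `X` outside some proper Zariski closed subset, relative
to the image of `Z`. -/
theorem exists_generic_openness {K σ τ : Type*} [NontriviallyNormedField K] [CompleteSpace K]
    [CharZero K] [Finite σ] [Finite τ] {Z : Set (σ → K)} (hZ : Z.Nonempty)
    (F : τ → MvPolynomial σ K) :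
    ∃ D : MvPolynomial σ K, (∃ x ∈ Z, eval x D ≠ 0) ∧ ∀ x ∈ Z, eval x D ≠ 0 → ∀ U ∈ 𝓝 x,
      ∃ W ∈ 𝓝 (fun t => eval x (F t)), ∀ x' ∈ Z, (fun t => eval x' (F t)) ∈ W →
        ∃ x'' ∈ U, (∀ p : MvPolynomial σ K, (∀ z ∈ Z, eval z p = 0) → eval x'' p = 0) ∧
          ∀ t, eval x'' (F t) = eval x' (F t) := by
  let I : Ideal (MvPolynomial σ K) := vanishingIdeal K Z
  have hIrad : I.IsRadical := by
    rintro p ⟨n, hn⟩ x hx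
    have := hn x hx
    rw [map_pow] at this
    exact eq_zero_of_pow_eq_zero this
  let Φ : MvPolynomial τ K →ₐ[K] MvPolynomial σ K := aeval F
  have hΦ : ∀ x P, eval x (Φ P) = eval (fun t => eval x (F t)) P := by
    intro x P
    change eval x (aeval F P) = _
    rw [aeval_def, algebraMap_eq, ← eval_assoc]
    rfl
  have hJrad : (I.comap Φ).IsRadical := hIrad.comap (Φ : MvPolynomial τ K →+* MvPolynomial σ K)
  have hJtop : I.comap Φ ≠ ⊤ := by
    intro h
    obtain ⟨x, hx⟩ := hZ
    have h1 : (1 : MvPolynomial τ K) ∈ I.comap Φ := h ▸ Submodule.mem_top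
    have := h1 x hx
    simp at this
  -- The component q of the closure of the image is chosen before a component p of the source above
  -- it. A point x' may lie on any component of the source, but its image, if close to that of x,
  -- must lie on q.
  obtain ⟨q, hq⟩ := Ideal.nonempty_minimalPrimes hJtop
  obtain ⟨p, hp, hpq⟩ := Ideal.exists_minimalPrimes_comap_eq
    (Φ : MvPolynomial τ K →+* MvPolynomial σ K) q hq
  have hpq' : ∀ a, a ∈ q ↔ Φ a ∈ p := fun a => by rw [← hpq]; rfl
  have hpp : p.IsPrime := hp.1.1
  obtain ⟨h, hhp, hh⟩ := exists_notMem_mul_mem_of_mem_minimalPrimes hIrad hp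
  obtain ⟨g, hgq, hg⟩ := exists_notMem_mul_mem_of_mem_minimalPrimes hJrad hq
  let M : MvPolynomial τ K →ₐ[K] MvPolynomial σ K ⧸ p := (Ideal.Quotient.mkₐ K p).comp Φ
  obtain ⟨s, hs⟩ := (inferInstance : Algebra.FiniteType K (MvPolynomial σ K ⧸ p)).out
  obtain ⟨D, hD0, hD⟩ := exists_ne_zero_openAtPoint_val s M.range (by rw [hs, sup_top_eq])
  obtain ⟨D, rfl⟩ := Ideal.Quotient.mkₐ_surjective K p D
  have hDp : D ∉ p := fun hmem => hD0 (Ideal.Quotient.eq_zero_iff_mem.2 hmem)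
  refine ⟨D * h * Φ g, ?_, ?_⟩
  · have hnp : D * h * Φ g ∉ p := fun hmem =>
      (hpp.mem_or_mem hmem).elim (fun hmem => (hpp.mem_or_mem hmem).elim hDp hhp)
        fun hmem => hgq ((hpq' g).2 hmem)
    by_contra! hall
    exact hnp (hp.1.2 hall)
  intro x hx hne U hU
  rw [map_mul, map_mul, mul_ne_zero_iff, mul_ne_zero_iff, hΦ] at hne
  obtain ⟨⟨hDx, hhx⟩, hgx⟩ := hne
  -- Since h does not vanish at x, the point x lies on the component of p.
  let χ : MvPolynomial σ K ⧸ p →ₐ[K] K := Ideal.Quotient.liftₐ p (aeval x) (by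
    intro a ha
    have h0 := hh a ha x hx
    rw [map_mul] at h0
    exact (mul_eq_zero.1 h0).resolve_left hhx)
  have hχ : ∀ P, χ (Ideal.Quotient.mkₐ K p P) = eval x P := fun P => rfl
  have hopen : OpenAtPoint M.range.val χ := hD χ hDx
  have hs : {χ' : MvPolynomial σ K ⧸ p →ₐ[K] K |
      (fun i => χ' (Ideal.Quotient.mkₐ K p (X i))) ∈ U} ∈ pointNhds χ := by
    have ht : Tendsto (fun (χ' : MvPolynomial σ K ⧸ p →ₐ[K] K) i =>
        χ' (Ideal.Quotient.mkₐ K p (X i))) (pointNhds χ) (𝓝 x) := by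
      refine tendsto_pi_nhds.2 fun i => ?_
      have := tendsto_apply_pointNhds χ (Ideal.Quotient.mkₐ K p (MvPolynomial.X i))
      rwa [hχ, eval_X] at this
    exact ht hU
  obtain ⟨T, hT, hTs⟩ := mem_comap.1 (hopen (image_mem_map hs))
  have hex : ∀ r : M.range, ∃ P, M P = r := fun r => r.2
  choose Q hQ using hex
  have hW : Tendsto (fun (w : τ → K) (r : M.range) => eval w (Q r))
      (𝓝 fun t => eval x (F t)) (𝓝 fun r => (χ.comp M.range.val) r) := by
    refine tendsto_pi_nhds.2 fun r => ?_
    have h1 : (χ.comp M.range.val) r = eval (fun t => eval x (F t)) (Q r) := by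
      change χ (r : MvPolynomial σ K ⧸ p) = _
      rw [← hQ r, ← hΦ]
      rfl
    rw [h1]
    exact (MvPolynomial.continuous_eval (Q r)).tendsto _
  have hgW : ∀ᶠ w in 𝓝 (fun t => eval x (F t)), eval w g ≠ 0 :=
    (MvPolynomial.continuous_eval g).continuousAt.eventually_ne hgx
  refine ⟨_, inter_mem (hW hT) hgW, ?_⟩
  rintro x' hx' ⟨hx'T, hx'g⟩
  have hker : ∀ P, M P = 0 → eval (fun t => eval x' (F t)) P = 0 := by
    intro P hP
    have hPq : P ∈ q := (hpq' P).2 (Ideal.Quotient.eq_zero_iff_mem.1 hP)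
    have h0 := hg P hPq x' hx'
    change eval x' (Φ _) = 0 at h0
    rw [hΦ, map_mul] at h0
    exact (mul_eq_zero.1 h0).resolve_left hx'g
  have hsurj : Function.Surjective M.rangeRestrict := M.rangeRestrict_surjective
  -- The image of x' kills q, so it is a K-point of the range of `M`; openness then lifts it to a
  -- point of the component p.
  have hlift := AlgHom.liftOfSurjective_apply M.rangeRestrict hsurj
    (aeval (fun t => eval x' (F t))) (fun P hP => hker P (congrArg Subtype.val hP))
  set ψ := AlgHom.liftOfSurjective M.rangeRestrict hsurj
    (aeval (fun t => eval x' (F t))) (fun P hP => hker P (congrArg Subtype.val hP))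
  have hψ : ∀ r, ψ r = eval (fun t => eval x' (F t)) (Q r) := by
    intro r
    rw [show r = M.rangeRestrict (Q r) from Subtype.ext (hQ r).symm, hlift]
    have : Q (M.rangeRestrict (Q r)) = Q r := congrArg Q (Subtype.ext (hQ r))
    rw [this]
    rfl
  obtain ⟨χ', hχ'U, hχ'⟩ : ψ ∈ (fun ψ : MvPolynomial σ K ⧸ p →ₐ[K] K => ψ.comp M.range.val) ''
      {χ' | (fun i => χ' (Ideal.Quotient.mkₐ K p (X i))) ∈ U} := by
    refine hTs ?_
    change (fun r => ψ r) ∈ T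
    simp only [hψ]
    exact hx'T
  have hev : ∀ P, eval (fun i => χ' (Ideal.Quotient.mkₐ K p (X i))) P =
      χ' (Ideal.Quotient.mkₐ K p P) := by
    intro P
    have : aeval (fun i => χ' (Ideal.Quotient.mkₐ K p (X i))) =
        χ'.comp (Ideal.Quotient.mkₐ K p) := by
      ext i
      simp
    exact congrArg (fun f : MvPolynomial σ K →ₐ[K] K => f P) this
  refine ⟨_, hχ'U, ?_, ?_⟩
  · intro P hP
    rw [hev, show Ideal.Quotient.mkₐ K p P = 0 from
      Ideal.Quotient.eq_zero_iff_mem.2 (hp.1.2 hP), map_zero]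
  · intro t
    have h1 := congrArg (fun f : M.range →ₐ[K] K => f (M.rangeRestrict (X t))) hχ'
    have h2 := hlift (X t)
    rw [aeval_X] at h2
    have h3 : M.range.val (M.rangeRestrict (X t)) = Ideal.Quotient.mkₐ K p (F t) := by
      change Ideal.Quotient.mkₐ K p (aeval F (MvPolynomial.X t)) = _
      rw [aeval_X]
    rw [hev, ← h3]
    exact h1.trans h2

end ZariskiOpenness


/-! ### Topology of P(V) and GL(V). -/

section Topology

variable {K V : Type*} [NontriviallyNormedField K] [NormedAddCommGroup V] [NormedSpace K V]

variable (K V) in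
/-- The projection `V ∖ {0} → P(V)`. -/
def projMk (v : {v : V // v ≠ 0}) : ℙ K V := Projectivization.mk K v.1 v.2

theorem projMk_eq_iff {v w : {v : V // v ≠ 0}} :
    projMk K V v = projMk K V w ↔ ∃ a : Kˣ, a • (w : V) = v :=
  Projectivization.mk_eq_mk_iff ..

theorem isOpenQuotientMap_projMk : IsOpenQuotientMap (projMk K V) where
  surjective x := ⟨⟨x.rep, x.rep_nonzero⟩, x.mk_rep⟩
  continuous := continuous_coinduced_rng
  isOpenMap U hU := by
    refine isOpen_coinduced.2 ?_
    have h : (fun v : {v : V // v ≠ 0} => Projectivization.mk K v.1 v.2) ⁻¹' (projMk K V '' U) =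
        ⋃ a : Kˣ, (fun v : {v : V // v ≠ 0} =>
          (⟨a • v.1, (smul_ne_zero_iff_ne a).2 v.2⟩ : {v : V // v ≠ 0})) ⁻¹' U := by
      ext v
      simp only [Set.mem_preimage, Set.mem_image, Set.mem_iUnion]
      constructor
      · rintro ⟨u, hu, he⟩
        obtain ⟨a, ha⟩ := projMk_eq_iff.1 he
        exact ⟨a, by simpa only [ha] using hu⟩
      · rintro ⟨a, ha⟩
        exact ⟨_, ha, projMk_eq_iff.2 ⟨a, rfl⟩⟩
    rw [h]
    refine isOpen_iUnion fun a => hU.preimage ?_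
    exact (continuous_subtype_val.const_smul (a : K)).subtype_mk _

instance instContinuousSMulProj : ContinuousSMul (GLV K V) (ℙ K V) where
  continuous_smul := by
    refine ((IsOpenQuotientMap.id (X := GLV K V)).prodMap
      (isOpenQuotientMap_projMk (K := K) (V := V))).continuous_comp_iff.1 ?_
    have h : Continuous fun p : GLV K V × {v : V // v ≠ 0} =>
        (⟨((p.1 : V →L[K] V) p.2.1 : V), (smul_ne_zero_iff_ne p.1).2 p.2.2⟩ : {v : V // v ≠ 0}) :=
      Continuous.subtype_mk ((Units.continuous_val.comp continuous_fst).clm_apply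
        (continuous_subtype_val.comp continuous_snd)) _
    exact (isOpenQuotientMap_projMk (K := K) (V := V)).continuous.comp h

/-- Two nonzero vectors span the same line exactly when they are dependent, and independence is an
open condition. -/
theorem isClosed_setOf_projMk_eq [CompleteSpace K] :
    IsClosed {q : {v : V // v ≠ 0} × {v : V // v ≠ 0} | projMk K V q.1 = projMk K V q.2} := by
  have h : {q : {v : V // v ≠ 0} × {v : V // v ≠ 0} | projMk K V q.1 = projMk K V q.2} =
      (fun q : {v : V // v ≠ 0} × {v : V // v ≠ 0} => ![(q.2 : V), (q.1 : V)]) ⁻¹'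
        {f : Fin 2 → V | LinearIndependent K f}ᶜ := by
    ext ⟨v, w⟩
    simp only [Set.mem_ofPred_eq, Set.mem_preimage, Set.mem_compl_iff,
      LinearIndependent.pair_iff' w.2, not_forall, not_not]
    rw [projMk, projMk, Projectivization.mk_eq_mk_iff']
  rw [h]
  refine (isOpen_setOfPred_linearIndependent.isClosed_compl).preimage ?_
  refine continuous_pi fun i => ?_
  fin_cases i
  · exact continuous_subtype_val.comp continuous_snd
  · exact continuous_subtype_val.comp continuous_fst

instance instT2SpaceProj [CompleteSpace K] : T2Space (ℙ K V) :=
  (t2Space_iff_of_isOpenQuotientMap (isOpenQuotientMap_projMk (K := K) (V := V))).2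
    isClosed_setOf_projMk_eq

theorem completeSpace_of_locallyCompactSpace (K : Type*) [NontriviallyNormedField K]
    [LocallyCompactSpace K] : CompleteSpace K :=
  have : ProperSpace K := .of_locallyCompactSpace K
  inferInstance

variable [LocallyCompactSpace K] [FiniteDimensional K V]

theorem secondCountableTopology_proj : SecondCountableTopology (ℙ K V) := by
  have : ProperSpace K := .of_locallyCompactSpace K
  have := FiniteDimensional.proper K V
  exact (isOpenQuotientMap_projMk (K := K) (V := V)).isQuotientMap.secondCountableTopology
    isOpenQuotientMap_projMk.isOpenMap

theorem locallyCompactSpace_proj : LocallyCompactSpace (ℙ K V) := by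
  have : ProperSpace K := .of_locallyCompactSpace K
  have := FiniteDimensional.proper K V
  have : LocallyCompactSpace {v : V // v ≠ 0} := isOpen_ne.locallyCompactSpace
  exact (isOpenQuotientMap_projMk (K := K) (V := V)).locallyCompactSpace

theorem metrizableSpace_proj : TopologicalSpace.MetrizableSpace (ℙ K V) := by
  have := completeSpace_of_locallyCompactSpace K
  have := secondCountableTopology_proj (K := K) (V := V)
  have := locallyCompactSpace_proj (K := K) (V := V)
  infer_instance

theorem properSpace_clm : ProperSpace (V →L[K] V) := by
  have : ProperSpace K := .of_locallyCompactSpace K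
  exact FiniteDimensional.proper K _

theorem isOpenEmbedding_val_GLV :
    IsOpenEmbedding (Units.val : GLV K V → V →L[K] V) := by
  have := completeSpace_of_locallyCompactSpace K
  have := FiniteDimensional.complete K V
  exact Units.isOpenEmbedding_val

theorem locallyCompactSpace_GLV : LocallyCompactSpace (GLV K V) := by
  have := properSpace_clm (K := K) (V := V)
  exact isOpenEmbedding_val_GLV.locallyCompactSpace

theorem secondCountableTopology_GLV : SecondCountableTopology (GLV K V) := by
  have := properSpace_clm (K := K) (V := V)
  exact (isOpenEmbedding_val_GLV (K := K) (V := V)).isEmbedding.secondCountableTopology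

end Topology


/-! ### Local transporters in an algebraic group acting on tuples of points. -/

section Transporter

open MvPolynomial Module

variable {K V : Type*} [NontriviallyNormedField K] [NormedAddCommGroup V] [NormedSpace K V]
variable {ι : Type*}

variable (K V ι) in
/-- The projection from tuples of nonzero vectors to tuples of points of `P(V)`. -/
def tupleMk (v : ι → {v : V // v ≠ 0}) : ι → ℙ K V := Pi.map (fun _ => projMk K V) v

theorem isOpenQuotientMap_tupleMk : IsOpenQuotientMap (tupleMk K V ι) :=
  IsOpenQuotientMap.piMap fun _ => isOpenQuotientMap_projMk

variable [FiniteDimensional K V]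

variable (K) in
/-- The coordinates of a tuple of vectors. -/
noncomputable def tupleCoord (v : ι → V) (p : ι × Fin (finrank K V)) : K :=
  (finBasis K V).repr (v p.1) p.2

theorem tupleCoord_injective : Function.Injective (tupleCoord K : (ι → V) → _) := by
  intro v w h
  funext i
  exact (finBasis K V).ext_elem fun a => congrFun h (i, a)

/-- The tuples of points of `P(V)` all of whose representatives are zeros of `J`. -/
def projZeros (J : Ideal (MvPolynomial (ι × Fin (finrank K V)) K)) : Set (ι → ℙ K V) :=
  {x | ∀ v, tupleMk K V ι v = x → J ≤ RingHom.ker (eval (tupleCoord K fun i => (v i : V)))}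

/-- The matrix entries of an endomorphism of `V`. -/
noncomputable def matrixEntries (T : V →L[K] V) (p : Fin (finrank K V) × Fin (finrank K V)) : K :=
  LinearMap.toMatrix (finBasis K V) (finBasis K V) (T : V →ₗ[K] V) p.1 p.2

/-- The coordinates of a triple consisting of an endomorphism, a tuple of scalars and a tuple of
vectors. -/
noncomputable def tripleCoord (T : V →L[K] V) (c : ι → K) (v : ι → V) :
    (Fin (finrank K V) × Fin (finrank K V)) ⊕ (ι ⊕ (ι × Fin (finrank K V))) → K :=
  Sum.elim (matrixEntries T) (Sum.elim c (tupleCoord K v))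

variable (K V ι) in
/-- The polynomial map `(T, c, v) ↦ (v, (cᵢ T vᵢ)ᵢ)`. -/
noncomputable def graphPoly : (ι × Fin (finrank K V)) ⊕ (ι × Fin (finrank K V)) →
    MvPolynomial ((Fin (finrank K V) × Fin (finrank K V)) ⊕ (ι ⊕ (ι × Fin (finrank K V)))) K :=
  Sum.elim (fun p => X (Sum.inr (Sum.inr p))) fun p =>
    X (Sum.inr (Sum.inl p.1)) *
      ∑ a, X (Sum.inl (p.2, a)) * X (Sum.inr (Sum.inr (p.1, a)))

theorem eval_graphPoly (T : V →L[K] V) (c : ι → K) (v : ι → V) :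
    (fun t => eval (tripleCoord T c v) (graphPoly K V ι t)) =
      Sum.elim (tupleCoord K v) (tupleCoord K fun i => c i • T (v i)) := by
  funext t
  rcases t with p | p
  · simp [graphPoly, tripleCoord]
  · simp only [graphPoly, tripleCoord, Sum.elim_inr, map_mul, map_sum, eval_X, Sum.elim_inl,
      tupleCoord, matrixEntries]
    have h := congrFun (LinearMap.toMatrix_mulVec_repr (finBasis K V) (finBasis K V)
      (T : V →ₗ[K] V) (v p.1)) p.2
    rw [map_smul, Finsupp.smul_apply, smul_eq_mul, ← ContinuousLinearMap.coe_coe, ← h]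
    rfl

section Complete

variable [CompleteSpace K]

theorem continuous_repr (a : Fin (finrank K V)) :
    Continuous fun v : V => (finBasis K V).repr v a :=
  ((finBasis K V).coord a).continuous_of_finiteDimensional

theorem continuous_tupleCoord : Continuous (tupleCoord K : (ι → V) → _) :=
  continuous_pi fun p => (continuous_repr p.2).comp (continuous_apply p.1)

theorem continuous_matrixEntries :
    Continuous (matrixEntries : (V →L[K] V) → _) := by
  refine continuous_pi fun p => ?_
  simp only [matrixEntries, LinearMap.toMatrix_apply]
  exact (continuous_repr p.1).comp (ContinuousLinearMap.apply K V (finBasis K V p.2)).continuous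

theorem isClosed_projZeros (J : Ideal (MvPolynomial (ι × Fin (finrank K V)) K)) :
    IsClosed (projZeros J : Set (ι → ℙ K V)) := by
  have h : (projZeros J : Set (ι → ℙ K V))ᶜ = tupleMk K V ι '' ⋃ p ∈ J,
      {v | eval (tupleCoord K fun i => (v i : V)) p ≠ 0} := by
    ext x
    simp only [projZeros, Set.mem_compl_iff, Set.mem_ofPred_eq, not_forall, Set.mem_image,
      Set.mem_iUnion, SetLike.not_le_iff_exists, RingHom.mem_ker]
    constructor
    · rintro ⟨v, hv, p, hp, hne⟩
      exact ⟨v, ⟨p, hp, hne⟩, hv⟩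
    · rintro ⟨v, ⟨p, hp, hne⟩, hv⟩
      exact ⟨v, hv, p, hp, hne⟩
  rw [← isOpen_compl_iff, h]
  refine isOpenQuotientMap_tupleMk.isOpenMap _ (isOpen_biUnion fun p _ => ?_)
  refine isOpen_ne.preimage ((MvPolynomial.continuous_eval p).comp (continuous_tupleCoord.comp ?_))
  exact continuous_pi fun i => continuous_subtype_val.comp (continuous_apply i)

/-- Decoding of `tripleCoord`. -/
theorem exists_decode_tripleCoord : ∃ T : ((Fin (finrank K V) × Fin (finrank K V)) ⊕
      (ι ⊕ (ι × Fin (finrank K V))) → K) → (V →L[K] V), Continuous T ∧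
    (∀ z, ∃ (c : ι → K) (v : ι → V), tripleCoord (T z) c v = z) ∧
    ∀ T' c v, T (tripleCoord T' c v) = T' := by
  let L : ((Fin (finrank K V) × Fin (finrank K V)) → K) →ₗ[K] (V →L[K] V) :=
    (LinearMap.toContinuousLinearMap.toLinearMap ∘ₗ
      (Matrix.toLin (finBasis K V) (finBasis K V)).toLinearMap) ∘ₗ
      (LinearEquiv.curry K K (Fin (finrank K V)) (Fin (finrank K V))).toLinearMap
  have hL : ∀ m, matrixEntries (L m) = m := by
    intro m
    funext p
    have h : ((L m : V →L[K] V) : V →ₗ[K] V) =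
      Matrix.toLin (finBasis K V) (finBasis K V) (Matrix.of (Function.curry m)) := rfl
    rw [matrixEntries, h, LinearMap.toMatrix_toLin]
    rfl
  have hL' : ∀ T, L (matrixEntries T) = T := by
    intro T
    refine ContinuousLinearMap.coe_injective ?_
    exact Matrix.toLin_toMatrix (finBasis K V) (finBasis K V) (T : V →ₗ[K] V)
  refine ⟨fun z => L (z ∘ Sum.inl), ?_, fun z => ?_, fun T' c v => hL' T'⟩
  · exact L.continuous_of_finiteDimensional.comp
      (continuous_pi fun p => continuous_apply (Sum.inl p))
  · refine ⟨fun i => z (Sum.inr (Sum.inl i)),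
      fun i => (finBasis K V).equivFun.symm fun a => z (Sum.inr (Sum.inr (i, a))), ?_⟩
    funext s
    rcases s with p | i | p
    · exact congrFun (hL _) p
    · rfl
    · change (finBasis K V).equivFun ((finBasis K V).equivFun.symm _) p.2 = _
      rw [LinearEquiv.apply_symm_apply]

end Complete

/-- This replaces openness of the map g ↦ g x onto the orbit, uniformly in x: nearby points x and k
x of C are joined by an element of H close to 1. -/
theorem exists_local_transporter [LocallyCompactSpace K] [CharZero K] [Finite ι]
    {S : Set (MvPolynomial (Fin (finrank K V) × Fin (finrank K V)) K)} {H : Subgroup (GLV K V)}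
    (hH : ∀ g : GLV K V, g ∈ H ↔ ∀ p ∈ S, eval (matrixEntries (g : V →L[K] V)) p = 0)
    (ν : Measure (ι → ℙ K V)) {A : Set (ι → ℙ K V)} (hA : MeasurableSet A) (hν : ν A ≠ 0)
    {N : Set (GLV K V)} (hN : N ∈ 𝓝 1) :
    ∃ C ⊆ A, MeasurableSet C ∧ ν C ≠ 0 ∧
      ∀ k ∈ H, ∀ x ∈ C, k • x ∈ C → ∃ k' ∈ H, k' ∈ N ∧ k' • x = k • x := by
  have := completeSpace_of_locallyCompactSpace K
  have := secondCountableTopology_proj (K := K) (V := V)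
  -- By noetherianity, take J maximal with zero set of positive measure in A; any further equation
  -- then cuts out a null set.
  obtain ⟨J, hJ, hJmax⟩ := (wellFounded_gt
    (α := Ideal (MvPolynomial (ι × Fin (finrank K V)) K))).has_min
    {J | ν (A ∩ projZeros J) ≠ 0} ⟨⊥, by
      have : (projZeros ⊥ : Set (ι → ℙ K V)) = Set.univ :=
        Set.eq_univ_of_forall fun x v _ => bot_le
      simpa [this] using hν⟩
  let Z : Set ((Fin (finrank K V) × Fin (finrank K V)) ⊕ (ι ⊕ (ι × Fin (finrank K V))) → K) :=
    {z | ∃ g ∈ H, ∃ (c : ι → Kˣ) (v : ι → {v : V // v ≠ 0}), tupleMk K V ι v ∈ projZeros J ∧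
      z = tripleCoord (g : V →L[K] V) (fun i => (c i : K)) fun i => v i}
  have hZ : Z.Nonempty := by
    obtain ⟨x, -, hx⟩ := nonempty_of_measure_ne_zero hJ
    obtain ⟨v, rfl⟩ := isOpenQuotientMap_tupleMk.surjective x
    exact ⟨_, 1, H.one_mem, 1, v, hx, rfl⟩
  obtain ⟨D, ⟨_, ⟨g₀, hg₀, c₀, v₀, hv₀, rfl⟩, hD₀⟩, hD⟩ :=
    exists_generic_openness hZ (graphPoly K V ι)
  -- Freezing the group element and the scalars at a point where D ≠ 0 leaves a polynomial in the
  -- vectors alone that is not in J.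
  let D₀ : MvPolynomial (ι × Fin (finrank K V)) K :=
    aeval (Sum.elim (fun p => C (matrixEntries (g₀ : V →L[K] V) p))
      (Sum.elim (fun i => C (c₀ i : K)) X)) D
  have hevD₀ : ∀ v : ι → V, eval (tupleCoord K v) D₀ =
      eval (tripleCoord (g₀ : V →L[K] V) (fun i => (c₀ i : K)) v) D := by
    intro v
    change eval _ (aeval _ D) = _
    rw [aeval_def, algebraMap_eq, ← eval_assoc]
    congr 2
    funext s
    rcases s with p | i | p <;> simp [tripleCoord]
  have hD₀J : D₀ ∉ J := fun hmem => hD₀ (by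
    rw [← hevD₀]
    exact hv₀ v₀ rfl hmem)
  have hnull : ν (A ∩ projZeros (J ⊔ Ideal.span {D₀})) = 0 := by
    by_contra hne
    refine hJmax _ hne (lt_of_le_of_ne le_sup_left fun h => hD₀J ?_)
    rw [h]
    exact (le_sup_right : _ ≤ J ⊔ Ideal.span {D₀}) (Ideal.mem_span_singleton_self D₀)
  have hpos : ν ((A ∩ projZeros J) \ (A ∩ projZeros (J ⊔ Ideal.span {D₀}))) ≠ 0 := by
    rwa [measure_sdiff_null hnull]
  -- A point off the exceptional set all of whose relative neighbourhoods have positive measure; C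
  -- is cut out around it.
  obtain ⟨x₁, ⟨⟨hx₁A, hx₁J⟩, hx₁⟩, hx₁pos⟩ := exists_mem_forall_mem_nhdsWithin_pos_measure hpos
  obtain ⟨v₁, rfl, hv₁⟩ : ∃ v, tupleMk K V ι v = x₁ ∧
      eval (tripleCoord (g₀ : V →L[K] V) (fun i => (c₀ i : K)) fun i => (v i : V)) D ≠ 0 := by
    by_contra! hall
    refine hx₁ ⟨hx₁A, fun v hv => sup_le (hx₁J v hv) ?_⟩
    rw [Ideal.span_singleton_le_iff_mem, RingHom.mem_ker, hevD₀]
    exact hall v hv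
  obtain ⟨T, hT, hTsurj, hTcoord⟩ := exists_decode_tripleCoord (K := K) (V := V) (ι := ι)
  -- The neighbourhood of triples whose endomorphism component lies in g₀ N.
  have hU : T ⁻¹' (Units.val '' ((fun u : GLV K V => g₀⁻¹ * u) ⁻¹' N)) ∈
      𝓝 (tripleCoord (g₀ : V →L[K] V) (fun i => (c₀ i : K)) fun i => (v₁ i : V)) := by
    refine hT.continuousAt.preimage_mem_nhds ?_
    rw [hTcoord]
    refine isOpenEmbedding_val_GLV.isOpenMap.image_mem_nhds ?_
    refine (continuous_const_mul g₀⁻¹).continuousAt.preimage_mem_nhds ?_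
    rwa [inv_mul_cancel]
  obtain ⟨W, hW, hWU⟩ := hD _ ⟨g₀, hg₀, c₀, v₁, hx₁J, rfl⟩ hv₁ _ hU
  rw [eval_graphPoly] at hW
  have hcont : Continuous fun q : (ι → {v : V // v ≠ 0}) × (ι → {v : V // v ≠ 0}) =>
      Sum.elim (tupleCoord K fun i => (q.1 i : V))
        (tupleCoord K fun i => (c₀ i : K) • (g₀ : V →L[K] V) (q.2 i)) := by
    have h1 : Continuous fun q : (ι → {v : V // v ≠ 0}) × (ι → {v : V // v ≠ 0}) =>
        tupleCoord K fun i => (q.1 i : V) := continuous_tupleCoord.comp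
      (continuous_pi fun i => continuous_subtype_val.comp
        ((continuous_apply i).comp continuous_fst))
    have h2 : Continuous fun q : (ι → {v : V // v ≠ 0}) × (ι → {v : V // v ≠ 0}) =>
        tupleCoord K fun i => (c₀ i : K) • (g₀ : V →L[K] V) (q.2 i) := continuous_tupleCoord.comp
      (continuous_pi fun i => ((g₀ : V →L[K] V).continuous.comp (continuous_subtype_val.comp
        ((continuous_apply i).comp continuous_snd))).const_smul _)
    refine continuous_pi fun t => ?_
    rcases t with p | p
    · exact (continuous_apply p).comp h1
    · exact (continuous_apply p).comp h2
  have hWpre := hcont.continuousAt.preimage_mem_nhds (x := (v₁, v₁)) hW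
  rw [nhds_prod_eq, Filter.mem_prod_self_iff] at hWpre
  obtain ⟨O, hO, hOW⟩ := hWpre
  obtain ⟨O', hO'O, hO', hv₁O'⟩ := mem_nhds_iff.1 hO
  have hPO' : IsOpen (tupleMk K V ι '' O') := isOpenQuotientMap_tupleMk.isOpenMap _ hO'
  refine ⟨A ∩ projZeros J ∩ tupleMk K V ι '' O', fun x hx => hx.1.1,
    (hA.inter (isClosed_projZeros J).measurableSet).inter hPO'.measurableSet, ?_, ?_⟩
  · refine (lt_of_lt_of_le (hx₁pos _ (Filter.inter_mem self_mem_nhdsWithin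
      (mem_nhdsWithin_of_mem_nhds (hPO'.mem_nhds ⟨v₁, hv₁O', rfl⟩)))) (measure_mono ?_)).ne'
    exact fun x hx => ⟨hx.1.1, hx.2⟩
  rintro k hk _ ⟨⟨-, hxJ⟩, v, hv, rfl⟩ ⟨-, w, hw, hwk⟩
  have hwa : ∀ i, ∃ a : Kˣ, a • (k : V →L[K] V) (v i) = (w i : V) := fun i =>
    (projMk_eq_iff (w := ⟨(k : V →L[K] V) (v i), (smul_ne_zero_iff_ne k).2 (v i).2⟩)).1
      (congrFun hwk i)
  choose a ha using hwa
  -- If w represents k x, the triple (g₀ k, c₀ a, v) in `Z` maps to (v, c₀ g₀ w), which is close to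
  -- (v₁, c₀ g₀ v₁). Openness gives u in g₀ N with the same image, so g₀⁻¹ u carries x to k x.
  have hgr : (fun i => (((c₀ * a) i : Kˣ) : K) • ((g₀ * k : GLV K V) : V →L[K] V) (v i)) =
      fun i => (c₀ i : K) • (g₀ : V →L[K] V) (w i) := by
    funext i
    rw [← ha i, Units.smul_def, map_smul, smul_smul]
    rfl
  obtain ⟨z, hzU, hzZ, hz⟩ := hWU (tripleCoord ((g₀ * k : GLV K V) : V →L[K] V)
    (fun i => (((c₀ * a) i : Kˣ) : K)) fun i => (v i : V))
    ⟨g₀ * k, H.mul_mem hg₀ hk, c₀ * a, v, hxJ, rfl⟩ (by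
      rw [eval_graphPoly, hgr]
      exact hOW (Set.mk_mem_prod (hO'O hv) (hO'O hw)))
  obtain ⟨c', v', hz'⟩ := hTsurj z
  obtain ⟨u, huN, huT⟩ := hzU
  rw [← huT] at hz'
  subst hz'
  have hz'' := (eval_graphPoly _ _ _).symm.trans ((funext hz).trans (eval_graphPoly _ _ _))
  rw [hgr] at hz''
  have hvv : v' = fun i => (v i : V) :=
    tupleCoord_injective (funext fun p => congrFun hz'' (Sum.inl p))
  have huw : (fun i => c' i • (u : V →L[K] V) (v' i)) =
      fun i => (c₀ i : K) • (g₀ : V →L[K] V) (w i) :=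
    tupleCoord_injective (funext fun p => congrFun hz'' (Sum.inr p))
  subst hvv
  -- The equations of H, read as polynomials in all coordinates, vanish on `Z`, hence at every point
  -- of its Zariski closure.
  have huH : u ∈ H := by
    refine (hH u).2 fun p hp => ?_
    have hren : ∀ (T : V →L[K] V) (c : ι → K) (v : ι → V),
        eval (tripleCoord T c v) (rename Sum.inl p) = eval (matrixEntries T) p := by
      intro T c v
      rw [eval_rename]
      rfl
    rw [← hren _ c' fun i => (v i : V)]
    refine hzZ _ ?_
    rintro _ ⟨g, hg, c, v, -, rfl⟩
    rw [hren]
    exact (hH g).1 hg p hp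
  refine ⟨g₀⁻¹ * u, H.mul_mem (H.inv_mem hg₀) huH, huN, ?_⟩
  funext i
  change (g₀⁻¹ * u) • projMk K V (v i) = k • projMk K V (v i)
  rw [mul_smul, inv_smul_eq_iff, ← mul_smul]
  refine (Projectivization.mk_eq_mk_iff' K _ _ _ _).2 ⟨(c' i)⁻¹ * ((c₀ i : K) * (a i : K)), ?_⟩
  have hi := congrFun huw i
  have hi' := congrFun hgr i
  simp only at hi hi'
  -- Scalars in the Zariski closure of `Z` could vanish; this one cannot, because it scales a vector
  -- to a nonzero one.
  have hne : c' i ≠ 0 := by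
    intro h0
    rw [h0, zero_smul] at hi
    have : g₀ • (w i : V) ≠ 0 := (smul_ne_zero_iff_ne g₀).2 (w i).2
    exact smul_ne_zero (c₀ i).ne_zero this hi.symm
  rw [mul_smul, inv_smul_eq_iff₀ hne]
  exact hi'.trans hi.symm

end Transporter


/-! ### Fixators of sets are stabilizers of finite tuples. -/

section Fixator

open Module

variable {K V : Type*} [NontriviallyNormedField K] [NormedAddCommGroup V] [NormedSpace K V]
  [FiniteDimensional K V]

/-- The linear map sending `T` to the `2 × 2` minors of the pair `(T v, v)`. -/
noncomputable def pairMinors (v : V) :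
    (V →L[K] V) →ₗ[K] (Fin (finrank K V) × Fin (finrank K V) → K) where
  toFun T p := (finBasis K V).repr (T v) p.1 * (finBasis K V).repr v p.2 -
    (finBasis K V).repr (T v) p.2 * (finBasis K V).repr v p.1
  map_add' S T := by
    funext p
    simp only [_root_.add_apply, map_add, Finsupp.add_apply, Pi.add_apply]
    ring
  map_smul' c T := by
    funext p
    simp only [_root_.smul_apply, map_smul, Finsupp.smul_apply, Pi.smul_apply,
      smul_eq_mul, RingHom.id_apply]
    ring

theorem pairMinors_eq_zero_iff (g : GLV K V) (v : {v : V // v ≠ 0}) :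
    pairMinors (v : V) (g : V →L[K] V) = 0 ↔ g • projMk K V v = projMk K V v := by
  have hmk : g • projMk K V v = projMk K V v ↔ ∃ a : K, a • (v : V) = g • (v : V) :=
    Projectivization.mk_eq_mk_iff' ..
  rw [hmk]
  constructor
  · intro h
    obtain ⟨b, hb⟩ : ∃ b, (finBasis K V).repr (v : V) b ≠ 0 := by
      by_contra! hall
      exact v.2 ((finBasis K V).ext_elem fun b => by simp [hall b])
    refine ⟨(finBasis K V).repr ((g : V →L[K] V) v) b / (finBasis K V).repr (v : V) b,
      (finBasis K V).ext_elem fun a => ?_⟩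
    have h' := congrFun h (a, b)
    simp only [pairMinors, LinearMap.coe_mk, AddHom.coe_mk, Pi.zero_apply] at h'
    rw [map_smul, Finsupp.smul_apply, smul_eq_mul, div_mul_eq_mul_div, div_eq_iff hb]
    exact (sub_eq_zero.1 h').symm
  · rintro ⟨a, ha⟩
    have ha' : (g : V →L[K] V) v = a • (v : V) := ha.symm
    funext p
    simp only [pairMinors, LinearMap.coe_mk, AddHom.coe_mk, Pi.zero_apply, ha', map_smul,
      Finsupp.smul_apply, smul_eq_mul]
    ring

theorem continuous_pairMinors [CompleteSpace K] (T : V →L[K] V) :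
    Continuous fun v : V => pairMinors v T := by
  refine continuous_pi fun p => ?_
  have h : ∀ a, Continuous fun v : V => (finBasis K V).repr (T v) a := fun a =>
    (continuous_repr a).comp T.continuous
  exact ((h p.1).mul (continuous_repr p.2)).sub ((h p.2).mul (continuous_repr p.1))

/-- The pointwise fixator of a set `E` in `P(V)` is the stabilizer of a finite tuple in `E`, and
of all tuples in `E` close to it. -/
theorem exists_isOpen_fixator [CompleteSpace K] (E : Set (ℙ K V)) :
    ∃ (t : Finset {v : V // v ≠ 0}) (s : t → ℙ K V) (O : Set (t → ℙ K V)), (∀ i, s i ∈ E) ∧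
      IsOpen O ∧ s ∈ O ∧ ∀ x ∈ O, (∀ i, x i ∈ E) → ∀ g : GLV K V, (∀ i, g • x i = x i) →
        ∀ y ∈ E, g • y = y := by
  classical
  let L : {v : {v : V // v ≠ 0} // projMk K V v ∈ E} → Submodule K (V →L[K] V) :=
    fun v => (pairMinors (v.1 : V)).ker
  -- Fixing a point is a linear condition on T, so in finite dimension finitely many points of E
  -- impose the conditions of all of E.
  obtain ⟨t', ht'⟩ := Finset.exists_inf_le L
  let t : Finset {v : V // v ≠ 0} := t'.map (Function.Embedding.subtype _)
  have htE : ∀ v ∈ t, projMk K V v ∈ E := by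
    intro v hv
    obtain ⟨w, -, rfl⟩ := Finset.mem_map.1 hv
    exact w.2
  let M := t'.inf L
  -- The conditions at the chosen tuple are injective on a complement Q of M, and injectivity
  -- persists for nearby tuples. For tuples in E the conditions still vanish on M, so their common
  -- kernel is exactly M.
  obtain ⟨Q, hQ⟩ := M.exists_isCompl
  let q := finBasis K Q
  let Ψ (v : t → {v : V // v ≠ 0}) :
      (V →L[K] V) →ₗ[K] (t → Fin (finrank K V) × Fin (finrank K V) → K) :=
    LinearMap.pi fun i => pairMinors (v i : V)
  let O' : Set (t → {v : V // v ≠ 0}) :=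
    {v | LinearIndependent K fun k => Ψ v (q k : V →L[K] V)}
  have hO' : IsOpen O' := by
    refine isOpen_setOfPred_linearIndependent.preimage (continuous_pi fun k => ?_)
    refine continuous_pi fun i => (continuous_pairMinors _).comp ?_
    exact continuous_subtype_val.comp (continuous_apply i)
  refine ⟨t, tupleMk K V t fun i => i, tupleMk K V t '' O', fun i => htE i i.2,
    isOpenQuotientMap_tupleMk.isOpenMap _ hO', ⟨_, ?_, rfl⟩, ?_⟩
  · have hker : ∀ T ∈ Q, Ψ (fun i => i) T = 0 → T = 0 := by
      intro T hTQ hT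
      have hTM : T ∈ M := by
        rw [Submodule.mem_finsetInf]
        intro v hv
        exact congrFun hT ⟨v.1, Finset.mem_map_of_mem _ hv⟩
      exact (Submodule.mem_bot K).1 (hQ.disjoint.le_bot ⟨hTM, hTQ⟩)
    refine q.linearIndependent.map' ((Ψ fun i => i).comp Q.subtype) (LinearMap.ker_eq_bot'.2 ?_)
    exact fun T hT => Subtype.ext (hker T T.2 hT)
  · rintro _ ⟨v, hv, rfl⟩ hvE g hg y hy
    obtain ⟨m, hm, T, hT, hmT⟩ := Submodule.mem_sup.1
      (hQ.sup_eq_top ▸ Submodule.mem_top : (g : V →L[K] V) ∈ M ⊔ Q)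
    have hΨg : Ψ v (g : V →L[K] V) = 0 :=
      funext fun i => (pairMinors_eq_zero_iff g (v i)).2 (hg i)
    have hΨm : Ψ v m = 0 := funext fun i => ht' ⟨v i, hvE i⟩ hm
    have hΨT : Ψ v T = 0 := by
      rwa [← hmT, map_add, hΨm, zero_add] at hΨg
    have hT0 : T = 0 := by
      obtain ⟨c, rfl⟩ : ∃ c : Fin (finrank K Q) → K, ∑ k, c k • (q k : V →L[K] V) = T := by
        have hsum := congrArg Q.subtype (q.sum_repr ⟨T, hT⟩)
        rw [map_sum] at hsum
        exact ⟨_, hsum⟩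
      have hz : ∑ k, c k • Ψ v (q k : V →L[K] V) = 0 := by
        rw [← hΨT, map_sum]
        simp only [map_smul]
      have hc := Fintype.linearIndependent_iff.1 hv _ hz
      exact Finset.sum_eq_zero fun k _ => by rw [hc k, zero_smul]
    obtain ⟨w, rfl⟩ := (isOpenQuotientMap_projMk (K := K) (V := V)).surjective y
    refine (pairMinors_eq_zero_iff g w).1 (ht' ⟨w, hy⟩ ?_)
    rwa [← hmT, hT0, add_zero]

end Fixator

/-! ### Packing translates of a set of positive measure. -/

section Packing

/-- A measure preserving action on a finite measure space: finitely many translates of a set of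
positive measure meet all its translates. -/
theorem exists_finset_forall_exists_smul_mem {Γ α : Type*} [Group Γ] [MulAction Γ α]
    [MeasurableSpace α] {ν : Measure α} [IsFiniteMeasure ν]
    (hν : ∀ g : Γ, MeasurePreserving (fun x : α => g • x) ν ν) {C : Set α}
    (hC : MeasurableSet C) (hC0 : ν C ≠ 0) :
    ∃ T : Finset Γ, ∀ g : Γ, ∃ t ∈ T, ∃ x ∈ C, (t⁻¹ * g) • x ∈ C := by
  by_contra! hcon
  -- Otherwise a greedy choice yields infinitely many pairwise disjoint translates of C of equal
  -- positive measure.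
  obtain ⟨f, -, hf⟩ := exists_seq_of_forall_finset_exists (fun _ : Γ => True)
    (fun t g => ∀ x ∈ C, (t⁻¹ * g) • x ∉ C) fun T _ =>
      (hcon T).imp fun g hg => ⟨trivial, hg⟩
  have hmeas : ∀ n, ν ((fun x => (f n)⁻¹ • x) ⁻¹' C) = ν C := fun n =>
    (hν _).measure_preimage hC.nullMeasurableSet
  obtain ⟨i, j, hij, y, hyi, hyj⟩ := exists_nonempty_inter_of_measure_univ_lt_tsum_measure ν
    (s := fun n => (fun x => (f n)⁻¹ • x) ⁻¹' C)
    (fun n => ((hν _).measurable hC).nullMeasurableSet) (by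
      simp only [hmeas]
      rw [ENNReal.tsum_const_eq_top_of_ne_zero hC0]
      exact measure_lt_top ν _)
  have key : ∀ m n, m < n → (f m)⁻¹ • y ∈ C → (f n)⁻¹ • y ∈ C → False := by
    intro m n hmn hm hn
    refine hf m n hmn _ hn ?_
    rwa [mul_smul, smul_inv_smul]
  rcases lt_or_gt_of_ne hij with h | h
  · exact key i j h hyi hyj
  · exact key j i h hyj hyi

end Packing


/-! ### Closedness of the groups and the finite compact cover. -/

section Stabilizer

variable {K V : Type*} [NontriviallyNormedField K] [NormedAddCommGroup V] [NormedSpace K V]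

theorem isClosed_iff_preimage_mk {s : Set (PGLV K V)} :
    IsClosed s ↔ IsClosed ((QuotientGroup.mk : GLV K V → PGLV K V) ⁻¹' s) :=
  (QuotientGroup.isQuotientMap_mk (N := (projHom K V).ker)).isClosed_preimage.symm

theorem smul_mem_support {μ : Measure (ℙ K V)} {g : PGLV K V}
    (hg : μ.map (fun x => g • x) = μ) {x : ℙ K V} (hx : x ∈ μ.support) :
    g • x ∈ μ.support := by
  rw [Measure.mem_support_iff_forall] at hx ⊢
  intro U hU
  obtain ⟨U', hU'U, hU', hxU'⟩ := mem_nhds_iff.1 hU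
  refine lt_of_lt_of_le ?_ (measure_mono hU'U)
  rw [← hg, Measure.map_apply (measurable_smul_proj g) hU'.measurableSet]
  exact hx _ ((hU'.preimage (continuous_smul_proj g)).mem_nhds hxU')

theorem normal_supportFixator_subgroupOf (G : Subgroup (PGLV K V)) (μ : Measure (ℙ K V)) :
    ((supportFixator G μ).subgroupOf (measureStabilizer G μ)).Normal where
  conj_mem i hi g := by
    rw [Subgroup.mem_subgroupOf] at hi ⊢
    intro x hx
    have hginv : (((g⁻¹ : measureStabilizer G μ) : G) : PGLV K V) • x ∈ μ.support :=
      smul_mem_support (g⁻¹).2 hx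
    change (((g : G) : PGLV K V) * ((i : G) : PGLV K V) *
      (((g⁻¹ : measureStabilizer G μ) : G) : PGLV K V)) • x = x
    rw [mul_smul, mul_smul, hi _ hginv, ← mul_smul]
    have : ((g : G) : PGLV K V) * (((g⁻¹ : measureStabilizer G μ) : G) : PGLV K V) = 1 :=
      mul_inv_cancel ((g : G) : PGLV K V)
    rw [this, one_smul]

variable [LocallyCompactSpace K]

theorem isClosed_supportFixator (G : Subgroup (PGLV K V)) (μ : Measure (ℙ K V)) :
    IsClosed (supportFixator G μ : Set G) := by
  have := completeSpace_of_locallyCompactSpace K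
  have h : IsClosed {g : PGLV K V | ∀ x ∈ μ.support, g • x = x} := by
    rw [isClosed_iff_preimage_mk]
    have h' : (QuotientGroup.mk : GLV K V → PGLV K V) ⁻¹'
        {g : PGLV K V | ∀ x ∈ μ.support, g • x = x} =
        ⋂ x ∈ μ.support, {g : GLV K V | g • x = x} := by
      ext g
      simp only [Set.mem_iInter]
      rfl
    rw [h']
    exact isClosed_biInter fun x _ =>
      isClosed_eq (continuous_id.smul continuous_const) continuous_const
  exact h.preimage continuous_subtype_val

variable [FiniteDimensional K V]

theorem IsAlgebraicSubgroup.isClosed {G : Subgroup (PGLV K V)} (hG : IsAlgebraicSubgroup G) :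
    IsClosed (G : Set (PGLV K V)) := by
  have := completeSpace_of_locallyCompactSpace K
  obtain ⟨S, hS⟩ := hG
  rw [isClosed_iff_preimage_mk]
  have h : (QuotientGroup.mk : GLV K V → PGLV K V) ⁻¹' (G : Set (PGLV K V)) =
      ⋂ p ∈ S, {g : GLV K V | MvPolynomial.eval (matrixEntries (g : V →L[K] V)) p = 0} := by
    ext g
    simp only [Set.mem_iInter]
    exact hS g
  rw [h]
  refine isClosed_biInter fun p _ => isClosed_eq ?_ continuous_const
  exact (MvPolynomial.continuous_eval p).comp
    (continuous_matrixEntries.comp Units.continuous_val)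

/-- A finite measure is determined by its integrals of bounded continuous functions f, and ∫ f(g x)
dμ is continuous in g by dominated convergence. -/
theorem isClosed_setOf_map_smul_eq (μ : Measure (ℙ K V)) [IsProbabilityMeasure μ] :
    IsClosed {g : PGLV K V | μ.map (fun x => g • x) = μ} := by
  have := metrizableSpace_proj (K := K) (V := V)
  have := secondCountableTopology_proj (K := K) (V := V)
  have := secondCountableTopology_GLV (K := K) (V := V)
  rw [isClosed_iff_preimage_mk]
  have h : (QuotientGroup.mk : GLV K V → PGLV K V) ⁻¹'
      {g : PGLV K V | μ.map (fun x => g • x) = μ} =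
      ⋂ f : BoundedContinuousFunction (ℙ K V) ℝ,
        {g : GLV K V | ∫ x, f (g • x) ∂μ = ∫ x, f x ∂μ} := by
    ext g
    have hm : Measurable fun x : ℙ K V => g • x := (continuous_const_smul g).measurable
    have hint : ∀ f : BoundedContinuousFunction (ℙ K V) ℝ,
        ∫ x, f x ∂(μ.map fun x => g • x) = ∫ x, f (g • x) ∂μ := fun f =>
      integral_map hm.aemeasurable f.continuous.aestronglyMeasurable
    have := Measure.isProbabilityMeasure_map (μ := μ) hm.aemeasurable
    simp only [Set.mem_iInter, Set.mem_ofPred_eq, ← hint]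
    change μ.map (fun x => g • x) = μ ↔ _
    exact ⟨fun h f => by rw [h], fun h => ext_of_forall_integral_eq_of_IsFiniteMeasure h⟩
  rw [h]
  refine isClosed_iInter fun f => isClosed_eq ?_ continuous_const
  refine continuous_of_dominated (bound := fun _ => ‖f‖)
    (fun g => (f.continuous.comp (continuous_const_smul g)).aestronglyMeasurable)
    (fun g => Filter.Eventually.of_forall fun x => f.norm_coe_le_norm _) (integrable_const _)
    (Filter.Eventually.of_forall fun x => f.continuous.comp (continuous_id.smul continuous_const))

theorem isClosed_measureStabilizer (G : Subgroup (PGLV K V)) (μ : Measure (ℙ K V))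
    [IsProbabilityMeasure μ] : IsClosed (measureStabilizer G μ : Set G) :=
  (isClosed_setOf_map_smul_eq μ).preimage continuous_subtype_val

theorem supportFixator_le_measureStabilizer (G : Subgroup (PGLV K V)) (μ : Measure (ℙ K V)) :
    supportFixator G μ ≤ measureStabilizer G μ := by
  have := secondCountableTopology_proj (K := K) (V := V)
  intro g hg
  change μ.map (fun x => (g : PGLV K V) • x) = μ
  have h : (fun x => (g : PGLV K V) • x) =ᵐ[μ] id := by
    filter_upwards [Measure.support_mem_ae (μ := μ)] with x hx using hg x hx
  rw [Measure.map_congr h, Measure.map_id]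

variable [CharZero K]

/-- Modulo the fixator of the support, the stabilizer of `μ` is covered by finitely many
translates of a compact set. -/
theorem exists_finset_compact_cover {G : Subgroup (PGLV K V)} (hG : IsAlgebraicSubgroup G)
    (μ : Measure (ℙ K V)) [IsProbabilityMeasure μ] :
    ∃ (T : Finset (measureStabilizer G μ)) (N : Set (measureStabilizer G μ)), IsCompact N ∧
      ∀ g, ∃ t ∈ T, ∃ n ∈ N, (t * n)⁻¹ * g ∈
        (supportFixator G μ).subgroupOf (measureStabilizer G μ) := by
  classical
  have := completeSpace_of_locallyCompactSpace K
  have := secondCountableTopology_proj (K := K) (V := V)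
  have := locallyCompactSpace_GLV (K := K) (V := V)
  have hGcl := hG.isClosed
  obtain ⟨S, hS⟩ := hG
  obtain ⟨N, hN, hN1⟩ := exists_compact_mem_nhds (1 : GLV K V)
  obtain ⟨t, s, O, hsE, hO, hsO, hfix⟩ := exists_isOpen_fixator μ.support
  let ν : Measure (t → ℙ K V) := Measure.pi fun _ => μ
  have hA : MeasurableSet (Set.univ.pi (fun _ : t => μ.support) ∩ O) :=
    (MeasurableSet.univ_pi fun _ => Measure.isClosed_support.measurableSet).inter hO.measurableSet
  -- A box around `s` inside O has positive measure because each `s i` is in the support, and almost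
  -- every tuple consists of support points.
  have hνA : ν (Set.univ.pi (fun _ : t => μ.support) ∩ O) ≠ 0 := by
    obtain ⟨u, hu, huO⟩ := (isOpen_pi_iff'.1 hO) s hsO
    have hpi : ν (Set.univ.pi u) ≠ 0 := by
      rw [Measure.pi_pi]
      refine Finset.prod_ne_zero_iff.2 fun i _ => ?_
      exact ((Measure.mem_support_iff_forall _).1 (hsE i) _ ((hu i).1.mem_nhds (hu i).2)).ne'
    have hsupp : ν (Set.univ.pi fun _ : t => μ.support)ᶜ = 0 := by
      have h : ∀ᵐ x ∂ν, ∀ i, x i ∈ μ.support := ae_all_iff.2 fun i =>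
        (Measure.quasiMeasurePreserving_eval (fun _ : t => μ) i).ae Measure.support_mem_ae
      refine measure_mono_null ?_ h
      intro x hx hx'
      exact hx fun i _ => hx' i
    intro h0
    refine hpi (measure_mono_null (t := (Set.univ.pi (fun _ : t => μ.support) ∩ O) ∪
      (Set.univ.pi fun _ : t => μ.support)ᶜ) ?_ (measure_union_null h0 hsupp))
    intro x hx
    by_cases hxs : x ∈ Set.univ.pi fun _ : t => μ.support
    · exact Or.inl ⟨hxs, huO hx⟩
    · exact Or.inr hxs
  obtain ⟨C, hCA, hC, hC0, htrans⟩ := exists_local_transporter (S := S)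
    (H := G.comap (QuotientGroup.mk' (projHom K V).ker)) hS ν hA hνA hN1
  let H : Subgroup (GLV K V) :=
    ((measureStabilizer G μ).map G.subtype).comap (QuotientGroup.mk' (projHom K V).ker)
  have hHmem : ∀ g ∈ H, ∃ n : measureStabilizer G μ,
      ((n : G) : PGLV K V) = QuotientGroup.mk g := by
    rintro g ⟨n, hn, he⟩
    exact ⟨⟨n, hn⟩, he⟩
  have hHmap : ∀ g ∈ H, μ.map (fun x => g • x) = μ := by
    rintro g ⟨n, hn, he⟩
    have hn' : μ.map (fun x => (n : PGLV K V) • x) = μ := hn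
    rwa [show (n : PGLV K V) = QuotientGroup.mk g from he] at hn'
  have hHpres : ∀ g : H, MeasurePreserving (fun x : t → ℙ K V => g • x) ν ν := fun g =>
    measurePreserving_pi (fun _ : t => μ) (fun _ : t => μ) fun _ =>
      ⟨(continuous_const_smul (g : GLV K V)).measurable, hHmap g g.2⟩
  obtain ⟨T, hT⟩ := exists_finset_forall_exists_smul_mem hHpres hC hC0
  choose φ hφ using fun g : H => hHmem g g.2
  -- The stabilizer is closed in PGL(V), so its intersection with the compact image of N is compact.
  have hemb : IsClosedEmbedding fun n : measureStabilizer G μ => ((n : G) : PGLV K V) :=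
    hGcl.isClosedEmbedding_subtypeVal.comp
      (isClosed_measureStabilizer G μ).isClosedEmbedding_subtypeVal
  refine ⟨T.image φ, (fun n : measureStabilizer G μ => ((n : G) : PGLV K V)) ⁻¹'
    (QuotientGroup.mk '' N), hemb.isCompact_preimage (hN.image QuotientGroup.continuous_mk),
    fun g => ?_⟩
  obtain ⟨γ, hγ⟩ := QuotientGroup.mk_surjective ((g : G) : PGLV K V)
  have hγH : γ ∈ H := ⟨(g : G), g.2, hγ.symm⟩
  obtain ⟨τ, hτT, x, hxC, hx⟩ := hT ⟨γ, hγH⟩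
  have hHG : ∀ h ∈ H, h ∈ G.comap (QuotientGroup.mk' (projHom K V).ker) := by
    rintro h ⟨n, -, he⟩
    exact Subgroup.mem_comap.2 (he ▸ n.2)
  obtain ⟨k, hkG, hkN, hk⟩ := htrans ((τ : GLV K V)⁻¹ * γ)
    (hHG _ (H.mul_mem (H.inv_mem τ.2) hγH)) x hxC hx
  have hi : ∀ y ∈ μ.support, (k⁻¹ * ((τ : GLV K V)⁻¹ * γ)) • y = y := by
    refine hfix x (hCA hxC).2 (fun i => (hCA hxC).1 i trivial) _ fun i => ?_
    rw [mul_smul, inv_smul_eq_iff]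
    exact (congrFun hk i).symm
  let i : G := (⟨QuotientGroup.mk k, hkG⟩ : G)⁻¹ * ((φ τ : G)⁻¹ * (g : G))
  have hival : (i : PGLV K V) = QuotientGroup.mk (k⁻¹ * ((τ : GLV K V)⁻¹ * γ)) := by
    change (QuotientGroup.mk k : PGLV K V)⁻¹ * (((φ τ : G) : PGLV K V)⁻¹ * ((g : G) : PGLV K V)) = _
    rw [hφ, ← hγ]
    rfl
  have hiI : i ∈ supportFixator G μ := by
    intro y hy
    rw [hival]
    exact hi y hy
  -- The transporter only provides k in G; it preserves μ because it differs from τ⁻¹ g by an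
  -- element fixing the support.
  have hk' : (⟨QuotientGroup.mk k, hkG⟩ : G) = (φ τ : G)⁻¹ * (g : G) * i⁻¹ := by
    simp only [i]
    group
  have hkst : (⟨QuotientGroup.mk k, hkG⟩ : G) ∈ measureStabilizer G μ := by
    rw [hk']
    exact mul_mem (mul_mem (inv_mem (φ τ).2) g.2)
      (inv_mem (supportFixator_le_measureStabilizer G μ hiI))
  refine ⟨φ τ, Finset.mem_image_of_mem _ hτT, ⟨_, hkst⟩, ⟨k, hkN, rfl⟩, ?_⟩
  rw [Subgroup.mem_subgroupOf]
  convert! hiI using 1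
  simp [i, mul_assoc]

end Stabilizer

end ProjStab


theorem proposition1 {K V : Type*} [NontriviallyNormedField K] [LocallyCompactSpace K] [CharZero K]
    [NormedAddCommGroup V] [NormedSpace K V] [FiniteDimensional K V]
    (G : Subgroup (ProjStab.PGLV K V)) (hG : ProjStab.IsAlgebraicSubgroup G)
    (μ : Measure (ℙ K V)) [IsProbabilityMeasure μ] :
    ProjStab.supportFixator G μ ≤ ProjStab.measureStabilizer G μ ∧
    ∃ _ : ((ProjStab.supportFixator G μ).subgroupOf (ProjStab.measureStabilizer G μ)).Normal,
      IsTopologicalGroup (ProjStab.measureStabilizer G μ ⧸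
        (ProjStab.supportFixator G μ).subgroupOf (ProjStab.measureStabilizer G μ)) ∧
      CompactSpace (ProjStab.measureStabilizer G μ ⧸
        (ProjStab.supportFixator G μ).subgroupOf (ProjStab.measureStabilizer G μ)) ∧
      T2Space (ProjStab.measureStabilizer G μ ⧸
        (ProjStab.supportFixator G μ).subgroupOf (ProjStab.measureStabilizer G μ)) := by
  have hnormal := ProjStab.normal_supportFixator_subgroupOf G μ
  refine ⟨ProjStab.supportFixator_le_measureStabilizer G μ, hnormal, inferInstance, ⟨?_⟩, ?_⟩
  · obtain ⟨T, N, hN, hcov⟩ := ProjStab.exists_finset_compact_cover hG μ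
    have hcompact : IsCompact (⋃ t ∈ T, (fun n : ProjStab.measureStabilizer G μ =>
        (QuotientGroup.mk (t * n) : ProjStab.measureStabilizer G μ ⧸
          (ProjStab.supportFixator G μ).subgroupOf (ProjStab.measureStabilizer G μ))) '' N) :=
      T.isCompact_biUnion fun t _ =>
        hN.image (QuotientGroup.continuous_mk.comp (continuous_const_mul t))
    convert hcompact
    refine (Set.eq_univ_of_forall fun q => ?_).symm
    obtain ⟨g, rfl⟩ := QuotientGroup.mk_surjective q
    obtain ⟨t, ht, n, hn, h⟩ := hcov g
    exact Set.mem_biUnion ht ⟨n, hn, QuotientGroup.eq.2 h⟩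
  · have hclosed : IsClosed ((ProjStab.supportFixator G μ).subgroupOf
        (ProjStab.measureStabilizer G μ) : Set (ProjStab.measureStabilizer G μ)) :=
      (ProjStab.isClosed_supportFixator G μ).preimage continuous_subtype_val
    infer_instance
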